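/- Let $A$ be a commutative ring. A Kronecker sequence of length $k$ attached to a finitely generated ideal $\mathfrak a$ of $A$ is a sequence $f_1,\dots,f_k$ of polynomials over $A$ in pairwise disjoint sets of variables $\underline X$, such that the coefficients of each $f_i$ generate $\mathfrak a$. For an $A$-module $E$ one writes $\mathrm{Gr}(\mathfrak a,E)\ge k$ if such a sequence of length $k$ is $E[\underline X]$-regular, i.e. each $f_i$ is a nonzerodivisor on $E[\underline X]/(f_1,\dots,f_{i-1})E[\underline X]$ (no condition $\mathfrak aE\ne E$ is imposed; the property does not depend on the chosen sequence, and always holds for $k=0$). If $\mathfrak a$ is only radically finitely generated, i.e. $\sqrt{\mathfrak a}=\sqrt{\mathfrak b}$ for some finitely generated ideal $\mathfrak b$, then $\mathrm{Gr}(\mathfrak a,E)\ge k$ means $\mathrm{Gr}(\mathfrak b,E)\ge k$ for such a $\mathfrak b$. Put $\mathrm{Gr}(\mathfrak a)=\mathrm{Gr}(\mathfrak a,A)$, and regard $\mathrm{Gr}(\mathfrak a,E)\in\mathbb N\cup\{\infty\}$ as the supremum of the $k$ with $\mathrm{Gr}(\mathfrak a,E)\ge k$. For a linear map $u$ between free modules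 of finite rank, $\mathcal D_1(u)$ is the ideal generated by the entries of a matrix of $u$. The projective dimension $\mathrm{Pd}(E)$ of a nonzero module $E$ is the least length of a resolution of $E$ by finitely generated projective modules. Let $E$ be an $A$-module with a finite free resolution of length $m\ge 0$, $$0\to L_m\xrightarrow{u_m}L_{m-1}\to\cdots\xrightarrow{u_1}L_0\xrightarrow{\pi}E\to 0,$$ i.e. an exact sequence in which the $L_j$ are free of finite rank. 1. (Direct part.) Let $k\in\mathbb N$ and let $\mathfrak a$ be a finitely generated ideal of $A$. If $\mathrm{Gr}(\mathfrak a)\ge k+m$, then $\mathrm{Gr}(\mathfrak a,E)\ge k$. 2. (Converse.) Let $k\in\mathbb N$ and let $\mathfrak a$ be a finitely generated ideal of $A$. Suppose that $m\ge 1$, that every $L_j$ $(0\le j\le m)$ has positive rank, that $\mathcal D_1(u_m)\subseteq\mathfrak a$ and that $\mathrm{Gr}(\mathfrak a,E)\ge k$. Then $\mathrm{Gr}(\mathfrak a)\ge k+m$. 3. (Local case.) Suppose that $A$ is a (nontrivial) local ring with maximal ideal $\mathfrak m$, that the resolution is minimal (the matrices of $u_1,\dots,u_m$ have all their entries in $\mathfrak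 m$), and that $L_m\ne 0$. Let $\mathfrak a\subseteq\mathfrak m$ be a radically finitely generated ideal such that, if $m\ge 1$, $\mathcal D_1(u_m)\subseteq\mathfrak a$. Then $\mathrm{Pd}(E)=m$ and $$\mathrm{Gr}(\mathfrak a,E)+\mathrm{Pd}(E)=\mathrm{Gr}(\mathfrak a);$$ in other words, for every $k\in\mathbb N$, $\mathrm{Gr}(\mathfrak a,E)\ge k$ if and only if $\mathrm{Gr}(\mathfrak a)\ge \mathrm{Pd}(E)+k$. -/

import Mathlib

open scoped TensorProduct

universe u v w

namespace ABH

/-- A Kronecker sequence attached to the ideal `a`: polynomials whose content ideal (the ideal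
generated by the coefficients) is `a`, and which use pairwise disjoint sets of variables. -/
def IsKroneckerSeq {A : Type u} [CommRing A] (a : Ideal A) (fs : List (MvPolynomial ℕ A)) : Prop :=
  (∀ f ∈ fs, Ideal.span (Set.range fun d => MvPolynomial.coeff d f) = a) ∧
    fs.Pairwise fun f g => Disjoint f.vars g.vars

/-- `Gr(a, E) ≥ k` for a finitely generated ideal `a`: a Kronecker sequence of length `k` attached
to `a` is `E[X]`-regular, where `E[X] = A[X] ⊗ E`. Regularity of a sequence carries no condition
of the kind `aE ≠ E`. For `k = 0` the empty sequence shows that the property always holds. -/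
def GradeGE {A : Type u} [CommRing A] (a : Ideal A) (E : Type v) [AddCommGroup E] [Module A E]
    (k : ℕ) : Prop :=
  ∃ fs : List (MvPolynomial ℕ A), fs.length = k ∧ IsKroneckerSeq a fs ∧
    RingTheory.Sequence.IsWeaklyRegular (MvPolynomial ℕ A ⊗[A] E) fs

/-- An ideal having the same radical as some finitely generated ideal. -/
def IsRadicallyFG {A : Type u} [CommRing A] (a : Ideal A) : Prop :=
  ∃ b : Ideal A, b.FG ∧ b.radical = a.radical

/-- `Gr(a, E) ≥ k` for a radically finitely generated ideal `a`: it holds for some finitely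
generated ideal with the same radical as `a`. -/
def RadGradeGE {A : Type u} [CommRing A] (a : Ideal A) (E : Type v) [AddCommGroup E] [Module A E]
    (k : ℕ) : Prop :=
  ∃ b : Ideal A, b.FG ∧ b.radical = a.radical ∧ GradeGE b E k

/-- The true grade (depth) `Gr(a, E)` of a radically finitely generated ideal `a` on `E`: the
supremum in `ℕ ∪ {∞}` of the `k` such that `Gr(a, E) ≥ k`. -/
noncomputable def grade {A : Type u} [CommRing A] (a : Ideal A) (E : Type v) [AddCommGroup E]
    [Module A E] : ℕ∞ :=
  ⨆ (k : ℕ) (_ : RadGradeGE a E k), (k : ℕ∞)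

/-- The maps form an exact sequence `0 → L m → L (m - 1) → ⋯ → L 0 → E → 0`. The map
`u j : L (j + 1) → L j` is the one usually written `u_{j+1}`; the modules are indexed by all of
`ℕ`, and those of index `> m` are zero. -/
structure IsResolution {A : Type u} [CommRing A] {E : Type v} [AddCommGroup E] [Module A E]
    {L : ℕ → Type w} [∀ j, AddCommGroup (L j)] [∀ j, Module A (L j)]
    (m : ℕ) (u : ∀ j, L (j + 1) →ₗ[A] L j) (π : L 0 →ₗ[A] E) : Prop where
  subsingleton : ∀ j, m < j → Subsingleton (L j)
  exact_succ : ∀ j, Function.Exact (u (j + 1)) (u j)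
  exact_zero : Function.Exact (u 0) π
  surjective : Function.Surjective π

/-- The determinantal ideal `D₁(f)` of a linear map between finite free modules, written without
bases; see `detIdealOne_eq_span_toMatrix`. -/
def detIdealOne {A : Type u} [CommRing A] {M : Type v} {N : Type w} [AddCommGroup M] [Module A M]
    [AddCommGroup N] [Module A N] (f : M →ₗ[A] N) : Ideal A :=
  Ideal.span {c | ∃ (x : M) (φ : Module.Dual A N), c = φ (f x)}

/-- `D₁(f)` is generated by the entries of the matrix of `f` in any bases. -/
theorem detIdealOne_eq_span_toMatrix {A : Type u} [CommRing A] {M : Type v} {N : Type w}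
    [AddCommGroup M] [Module A M] [AddCommGroup N] [Module A N] {ι κ : Type*} [Fintype ι]
    [DecidableEq ι] [Fintype κ] (b : Module.Basis ι A M) (c : Module.Basis κ A N)
    (f : M →ₗ[A] N) :
    detIdealOne f =
      Ideal.span (Set.range fun p : κ × ι => LinearMap.toMatrix b c f p.1 p.2) := by
  apply le_antisymm
  · refine Ideal.span_le.2 ?_
    rintro _ ⟨x, φ, rfl⟩
    have h : φ (f x) = ∑ i, ∑ j, b.repr x i * LinearMap.toMatrix b c f j i * φ (c j) := by
      conv_lhs => rw [← b.sum_repr x]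
      simp only [map_sum, map_smul, smul_eq_mul]
      refine Finset.sum_congr rfl fun i _ => ?_
      conv_lhs => rw [← c.sum_repr (f (b i))]
      simp only [map_sum, map_smul, smul_eq_mul, Finset.mul_sum, LinearMap.toMatrix_apply,
        mul_assoc]
    rw [SetLike.mem_coe, h]
    refine Ideal.sum_mem _ fun i _ => Ideal.sum_mem _ fun j _ => ?_
    exact Ideal.mul_mem_right _ _ (Ideal.mul_mem_left _ _ (Ideal.subset_span ⟨(j, i), rfl⟩))
  · refine Ideal.span_le.2 ?_
    rintro _ ⟨⟨j, i⟩, rfl⟩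
    refine Ideal.subset_span ⟨b i, c.coord j, ?_⟩
    simp [LinearMap.toMatrix_apply]

/-- A finite free resolution is minimal if all the matrices of its maps have their entries in the
Jacobson radical of the ring. -/
def IsMinimal {A : Type u} [CommRing A] {L : ℕ → Type w} [∀ j, AddCommGroup (L j)]
    [∀ j, Module A (L j)] (u : ∀ j, L (j + 1) →ₗ[A] L j) : Prop :=
  ∀ j, detIdealOne (u j) ≤ (⊥ : Ideal A).jacobson

/-- `Pd(E) ≤ n` for `n : ℕ`: there is a resolution of length `n` of `E` by finitely generated
projective modules. -/
def PdLE (A : Type u) [CommRing A] (E : Type v) [AddCommGroup E] [Module A E] (n : ℕ) : Prop :=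
  ∃ (P : ℕ → Type u) (_ : ∀ j, AddCommGroup (P j)) (_ : ∀ j, Module A (P j))
    (u : ∀ j, P (j + 1) →ₗ[A] P j) (π : P 0 →ₗ[A] E),
    (∀ j, Module.Finite A (P j)) ∧ (∀ j, Module.Projective A (P j)) ∧ IsResolution n u π

open Classical in
/-- The (finitary) projective dimension `Pd(E)`: the least `n` with `Pd(E) ≤ n`, or `∞` if there is
none. The value for the zero module, often written `-1`, is `⊥`. -/
noncomputable def projDim (A : Type u) [CommRing A] (E : Type v) [AddCommGroup E] [Module A E] :
    WithBot ℕ∞ :=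
  if Subsingleton E then ⊥ else ((⨅ (n : ℕ) (_ : PdLE A E n), (n : ℕ∞) : ℕ∞) : WithBot ℕ∞)

end ABH

/-! ### Polynomial-like modules and McCoy's theorem -/

namespace ABH

open MvPolynomial
open scoped Pointwise

/-! The polynomials of a Kronecker sequence use disjoint variables. After division by some of them,
the quotient is still a module of polynomials in the remaining variables (`IsVarGraded`), so McCoy's
theorem (`IsVarGraded.isSMulRegular`) applies: a polynomial in fresh variables whose coefficients
generate 𝔞 is regular as soon as no nonzero element is killed by 𝔞. Regularity becomes a torsion
question about 𝔞, and grade behaves like classical depth without Noetherian hypotheses.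

Direct part: along a short exact sequence the quotient loses at most one unit of depth
(`isWeaklyRegular_of_shortExact`); induction over the syzygies gives a loss of at most `m`. The same
lemma, applied to multiplication by a regular polynomial, allows one Kronecker sequence to be
exchanged for another and makes grade monotone in the ideal.

Converse: `u_m` is injective with entries in 𝔞, so an element of `L_m[X]` killed by 𝔞 is killed by
`u_m` and vanishes. Hence the first polynomial is regular on `L_m[X]`, then on `A[X]` since the rank
is positive, then on every `L_j[X]`. The argument repeats modulo that polynomial. The `k`
polynomials regular on `E[X]` leave the whole complex exact; each further one costs one degree at
the right end, and there are `m` degrees to spend (`isWeaklyRegular_append_of_exact`).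

Local case: if `Pd(E) < m`, some syzygy would make `u_m` a split injection, which Nakayama forbids
for entries in the maximal ideal. The formula combines both parts, after enlarging a finitely
generated ideal with the right radical so that it contains `D₁(u_m)`. -/

/-- A module over `A[X]` which looks like a module of polynomials in the variables outside `S`:
there are maps extracting the coefficient of each monomial in these variables. -/
def IsVarGraded {A : Type*} [CommRing A] (S : Set ℕ) (Q : Type*) [AddCommGroup Q]
    [Module (MvPolynomial ℕ A) Q] : Prop :=
  ∃ p : (ℕ →₀ ℕ) → Q →+ Q,
    (∀ x, ∃ F : Finset (ℕ →₀ ℕ), (∀ d ∉ F, p d x = 0) ∧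
      x = ∑ d ∈ F, (monomial d (1 : A)) • p d x) ∧
    (∀ g : MvPolynomial ℕ A, (g.vars : Set ℕ) ⊆ S → ∀ d x, p d (g • x) = g • p d x) ∧
    ∀ c : ℕ →₀ ℕ, (∀ i ∈ S, c i = 0) → ∀ d x,
      p d ((monomial c (1 : A)) • x) = if c ≤ d then p (d - c) x else 0

/-- `Q` has no nonzero element killed by the ideal `a` of the coefficient ring. -/
def TorsionFreeAt {A : Type*} [CommRing A] (a : Ideal A) (Q : Type*) [AddCommGroup Q]
    [Module (MvPolynomial ℕ A) Q] : Prop :=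
  ∀ x : Q, (∀ c ∈ a, (C c : MvPolynomial ℕ A) • x = 0) → x = 0

variable {A : Type*} [CommRing A]

theorem smul_eq_sum_coeff {Q : Type*} [AddCommGroup Q] [Module (MvPolynomial ℕ A) Q]
    (f : MvPolynomial ℕ A) (x : Q) :
    f • x = ∑ c ∈ f.support, (monomial c (1 : A)) • (C (coeff c f) : MvPolynomial ℕ A) • x := by
  conv_lhs => rw [f.as_sum, Finset.sum_smul]
  refine Finset.sum_congr rfl fun c _ => ?_
  rw [smul_smul, mul_comm, C_mul_monomial, mul_one]

theorem smul_eq_zero_of_coeff {Q : Type*} [AddCommGroup Q] [Module (MvPolynomial ℕ A) Q]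
    {a : Ideal A} {f : MvPolynomial ℕ A} (hf : Ideal.span (Set.range fun d => coeff d f) ≤ a)
    {x : Q} (hx : ∀ c ∈ a, (C c : MvPolynomial ℕ A) • x = 0) : f • x = 0 := by
  rw [smul_eq_sum_coeff]
  refine Finset.sum_eq_zero fun c _ => ?_
  rw [hx _ (hf (Ideal.subset_span ⟨c, rfl⟩)), smul_zero]

theorem TorsionFreeAt.of_isSMulRegular {Q : Type*} [AddCommGroup Q] [Module (MvPolynomial ℕ A) Q]
    {a : Ideal A} {f : MvPolynomial ℕ A} (hf : Ideal.span (Set.range fun d => coeff d f) ≤ a)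
    (h : IsSMulRegular Q f) : TorsionFreeAt a Q := fun x hx =>
  isSMulRegular_iff_right_eq_zero_of_smul.1 h x (smul_eq_zero_of_coeff hf hx)

/-- McCoy's theorem for modules. -/
theorem IsVarGraded.isSMulRegular {S : Set ℕ} {Q : Type*} [AddCommGroup Q]
    [Module (MvPolynomial ℕ A) Q] (hQ : IsVarGraded (A := A) S Q) {a : Ideal A}
    (ha : TorsionFreeAt a Q) {f : MvPolynomial ℕ A} (hfS : ∀ i ∈ f.vars, i ∉ S)
    (hf : a ≤ Ideal.span (Set.range fun d => coeff d f)) : IsSMulRegular Q f := by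
  classical
  obtain ⟨p, hsum, hlin, hshift⟩ := hQ
  have hC : ∀ (b : A) d (x : Q), p d ((C b : MvPolynomial ℕ A) • x) =
      (C b : MvPolynomial ℕ A) • p d x := fun b d x => hlin _ (by simp) d x
  have hcS : ∀ c ∈ f.support, ∀ i ∈ S, c i = 0 := fun c hc i hi => by
    by_contra h
    exact hfS i ((mem_vars_iff_mem_support i).2 ⟨c, hc, Finsupp.mem_support_iff.2 h⟩) hi
  have hpf : ∀ n x, p n (f • x) = ∑ c ∈ f.support,
      if c ≤ n then (C (coeff c f) : MvPolynomial ℕ A) • p (n - c) x else 0 := fun n x => by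
    rw [smul_eq_sum_coeff, map_sum]
    refine Finset.sum_congr rfl fun c hc => ?_
    rw [hshift c (hcS c hc), hC]
  rw [isSMulRegular_iff_right_eq_zero_of_smul]
  -- Induction on the size of a finite set `F` containing all exponents of `x`.
  suffices H : ∀ (N : ℕ) (x : Q) (F : Finset (ℕ →₀ ℕ)), F.card = N → (∀ d ∉ F, p d x = 0) →
      f • x = 0 → x = 0 by
    intro x hx
    obtain ⟨F, hF, -⟩ := hsum x
    exact H _ x F rfl hF hx
  intro N
  induction N with
  | zero =>
    intro x F hN hF _
    obtain ⟨G, -, hG⟩ := hsum x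
    rw [Finset.card_eq_zero] at hN
    subst hN
    rw [hG]
    exact Finset.sum_eq_zero fun d _ => by rw [hF d (by simp), smul_zero]
  | succ N ih =>
    intro x F hN hF hfx
    have hne : F.Nonempty := Finset.card_pos.1 (by omega)
    obtain ⟨e, heF, he⟩ := Finset.exists_max_image F (fun d => toLex d) hne
    -- Take the lex-largest `c` whose coefficient in `f` does not kill `x`. In degree `c + e` of `f
    -- • x = 0` only the pair `(c, e)` survives, so this coefficient kills `p e x`. Multiplying `x`
    -- by it removes `e` from `F`, and the induction hypothesis gives a contradiction.
    have key : ∀ c, (C (coeff c f) : MvPolynomial ℕ A) • x = 0 := by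
      by_contra! hcon
      let B := f.support.filter fun c => (C (coeff c f) : MvPolynomial ℕ A) • x ≠ 0
      have hB : B.Nonempty := by
        obtain ⟨c, hc⟩ := hcon
        refine ⟨c, Finset.mem_filter.2 ⟨mem_support_iff.2 fun h => hc ?_, hc⟩⟩
        rw [h, C_0, zero_smul]
      obtain ⟨c, hcB, hc⟩ := Finset.exists_max_image B (fun d => toLex d) hB
      have hcB' := Finset.mem_filter.1 hcB
      refine hcB'.2 (ih _ (F.erase e) (by rw [Finset.card_erase_of_mem heF, hN]; rfl) ?_ ?_)
      · intro d hd
        rw [hC]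
        by_cases hdF : d ∈ F
        · have hde : d = e := by
            by_contra hde
            exact hd (Finset.mem_erase.2 ⟨hde, hdF⟩)
          subst hde
          have h0 := hpf (c + d) x
          rw [hfx, map_zero, Finset.sum_eq_single c] at h0
          · rw [if_pos le_self_add, add_tsub_cancel_left] at h0
            exact h0.symm
          · intro c' hc' hne
            split_ifs with hle
            · by_cases hz : (C (coeff c' f) : MvPolynomial ℕ A) • x = 0
              · rw [← hC, hz, map_zero]
              · have hlt : toLex c' < toLex c :=
                  lt_of_le_of_ne (hc c' (Finset.mem_filter.2 ⟨hc', hz⟩))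
                    fun h => hne (toLex.injective h)
                -- A smaller `c'` would need an exponent of `x` larger than the maximum of `F`.
                rw [hF _ fun hmem => ?_, smul_zero]
                have h1 : toLex (c + d - c') ≤ toLex d := he _ hmem
                have h2 : toLex c' + toLex (c + d - c') = toLex c + toLex d := by
                  rw [← toLex_add, ← toLex_add, add_tsub_cancel_of_le hle]
                exact (add_lt_add_of_lt_of_le hlt h1).ne h2
            · rfl
          · intro h
            exact absurd hcB'.1 h
        · rw [hF d hdF, smul_zero]
      · rw [smul_comm, hfx, smul_zero]
    refine ha x fun c hc => ?_
    have h1 : a ≤ Ideal.comap (C : A →+* MvPolynomial ℕ A)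
        (LinearMap.ker (LinearMap.toSpanSingleton (MvPolynomial ℕ A) Q x)) := by
      refine hf.trans (Ideal.span_le.2 ?_)
      rintro _ ⟨d, rfl⟩
      simpa using key d
    simpa using h1 hc

/-- Polynomials in the variables of `S` act coefficientwise, so the coefficient maps preserve `g •
⊤` and descend to the quotient. -/
theorem IsVarGraded.quotSMulTop {S : Set ℕ} {Q : Type*} [AddCommGroup Q]
    [Module (MvPolynomial ℕ A) Q] (hQ : IsVarGraded (A := A) S Q) {g : MvPolynomial ℕ A}
    (hg : (g.vars : Set ℕ) ⊆ S) : IsVarGraded (A := A) S (QuotSMulTop g Q) := by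
  obtain ⟨p, hsum, hlin, hshift⟩ := hQ
  have hW : ∀ d, ∀ x ∈ g • (⊤ : Submodule (MvPolynomial ℕ A) Q), p d x ∈
      g • (⊤ : Submodule (MvPolynomial ℕ A) Q) := by
    intro d x hx
    obtain ⟨y, -, rfl⟩ := (Submodule.mem_smul_pointwise_iff_exists _ _ _).1 hx
    rw [hlin g hg d y]
    exact Submodule.smul_mem_pointwise_smul _ _ _ trivial
  let P : (ℕ →₀ ℕ) → QuotSMulTop g Q →+ QuotSMulTop g Q := fun d =>
    QuotientAddGroup.map (g • (⊤ : Submodule (MvPolynomial ℕ A) Q)).toAddSubgroup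
      (g • (⊤ : Submodule (MvPolynomial ℕ A) Q)).toAddSubgroup (p d) (hW d)
  have hP : ∀ d x, P d (Submodule.Quotient.mk x) = Submodule.Quotient.mk (p d x) := fun _ _ => rfl
  refine ⟨P, ?_, ?_, ?_⟩
  · intro x
    obtain ⟨x, rfl⟩ := Submodule.Quotient.mk_surjective _ x
    obtain ⟨F, hF, hx⟩ := hsum x
    refine ⟨F, fun d hd => by rw [hP, hF d hd, Submodule.Quotient.mk_zero], ?_⟩
    conv_lhs => rw [hx]
    rw [← Submodule.mkQ_apply, map_sum]
    rfl
  · intro h hh d x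
    obtain ⟨x, rfl⟩ := Submodule.Quotient.mk_surjective _ x
    rw [hP, ← Submodule.Quotient.mk_smul, hP, hlin h hh, Submodule.Quotient.mk_smul]
  · intro c hc d x
    obtain ⟨x, rfl⟩ := Submodule.Quotient.mk_surjective _ x
    rw [← Submodule.Quotient.mk_smul, hP, hP, hshift c hc]
    split_ifs <;> rfl

open Classical in
/-- The coefficient of the monomial `d` in the variables outside `S`, a polynomial in the variables
in `S`. -/
noncomputable def varCoeff (A : Type*) [CommRing A] (S : Set ℕ) (d : ℕ →₀ ℕ) :
    MvPolynomial ℕ A →ₗ[A] MvPolynomial ℕ A :=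
  (basisMonomials ℕ A).constr A fun c =>
    if c.filter (· ∉ S) = d then monomial (c.filter (· ∈ S)) 1 else 0

open Classical in
theorem varCoeff_monomial (S : Set ℕ) (d c : ℕ →₀ ℕ) :
    varCoeff A S d (monomial c 1) =
      if c.filter (· ∉ S) = d then monomial (c.filter (· ∈ S)) 1 else 0 := by
  have := (basisMonomials ℕ A).constr_basis A (fun c : ℕ →₀ ℕ =>
    if c.filter (· ∉ S) = d then (monomial (c.filter (· ∈ S)) 1 : MvPolynomial ℕ A) else 0) c
  rwa [coe_basisMonomials] at this

theorem varCoeff_mul {S : Set ℕ} (d : ℕ →₀ ℕ) {g : MvPolynomial ℕ A} (hg : (g.vars : Set ℕ) ⊆ S)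
    (r : MvPolynomial ℕ A) : varCoeff A S d (g * r) = g * varCoeff A S d r := by
  classical
  rw [← mem_supported] at hg
  induction hg using Algebra.adjoin_induction generalizing r with
  | mem x hx =>
    obtain ⟨i, hi, rfl⟩ := hx
    have : varCoeff A S d ∘ₗ LinearMap.mulLeft A (X i) =
        LinearMap.mulLeft A (X i) ∘ₗ varCoeff A S d := by
      refine (basisMonomials ℕ A).ext fun c => ?_
      simp only [coe_basisMonomials, LinearMap.comp_apply, LinearMap.mulLeft_apply]
      rw [X, monomial_mul, one_mul, varCoeff_monomial, varCoeff_monomial, Finsupp.filter_add,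
        Finsupp.filter_add, Finsupp.filter_single_of_neg _ (by simpa using hi),
        Finsupp.filter_single_of_pos _ hi, zero_add, mul_ite, mul_zero, monomial_mul, one_mul]
    exact LinearMap.congr_fun this r
  | algebraMap a => rw [← Algebra.smul_def, ← Algebra.smul_def, map_smul]
  | add x y _ _ hx hy => rw [add_mul, map_add, hx, hy, add_mul]
  | mul x y _ _ hx hy => rw [mul_assoc, hx, hy, mul_assoc]

theorem varCoeff_monomial_mul {S : Set ℕ} {c : ℕ →₀ ℕ} (hc : ∀ i ∈ S, c i = 0) (d : ℕ →₀ ℕ)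
    (r : MvPolynomial ℕ A) : varCoeff A S d (monomial c 1 * r) =
      if c ≤ d then varCoeff A S (d - c) r else 0 := by
  classical
  have : varCoeff A S d ∘ₗ LinearMap.mulLeft A (monomial c 1) =
      if c ≤ d then varCoeff A S (d - c) else 0 := by
    refine (basisMonomials ℕ A).ext fun e => ?_
    have h1 : c.filter (· ∈ S) = 0 := by
      ext i
      by_cases hi : i ∈ S <;> simp [hi, hc]
    have h2 : c.filter (· ∉ S) = c := by
      ext i
      by_cases hi : i ∈ S <;> simp [hi, hc]
    simp only [coe_basisMonomials, LinearMap.comp_apply, LinearMap.mulLeft_apply]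
    rw [monomial_mul, one_mul, varCoeff_monomial, Finsupp.filter_add, Finsupp.filter_add, h1, h2,
      zero_add]
    split_ifs with h3 h4 h4
    · rw [varCoeff_monomial, if_pos]
      rw [← h3, add_tsub_cancel_left]
    · exact absurd (h3 ▸ le_self_add) h4
    · rw [varCoeff_monomial, if_neg]
      rintro h5
      exact h3 (by rw [h5, add_tsub_cancel_of_le h4])
    · rfl
  have h := LinearMap.congr_fun this r
  simp only [LinearMap.comp_apply, LinearMap.mulLeft_apply] at h
  rw [h]
  split_ifs <;> rfl

theorem isVarGraded_tensor (S : Set ℕ) (E : Type*) [AddCommGroup E] [Module A E] :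
    IsVarGraded (A := A) S (MvPolynomial ℕ A ⊗[A] E) := by
  classical
  refine ⟨fun d => ((varCoeff A S d).rTensor E).toAddMonoidHom, ?_, ?_, ?_⟩
  · intro x
    simp only [LinearMap.toAddMonoidHom_coe]
    induction x with
    | zero => exact ⟨∅, by simp⟩
    | add x y hx hy =>
      obtain ⟨F, hF, hx⟩ := hx
      obtain ⟨G, hG, hy⟩ := hy
      refine ⟨F ∪ G, fun d hd => ?_, ?_⟩
      · simp only [Finset.mem_union, not_or] at hd
        rw [map_add, hF d hd.1, hG d hd.2, add_zero]
      · simp only [map_add, smul_add, Finset.sum_add_distrib]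
        conv_lhs => rw [hx, hy]
        congr 1
        · exact Finset.sum_subset Finset.subset_union_left fun d _ hd => by
            rw [hF d hd, smul_zero]
        · exact Finset.sum_subset Finset.subset_union_right fun d _ hd => by
            rw [hG d hd, smul_zero]
    | tmul r e =>
      induction r using MvPolynomial.induction_on' with
      | monomial c a =>
        have hca : monomial c a ⊗ₜ[A] e = monomial c (1 : A) ⊗ₜ[A] (a • e) := by
          rw [← TensorProduct.smul_tmul, smul_monomial, smul_eq_mul, mul_one]
        rw [hca]
        refine ⟨{c.filter (· ∉ S)}, fun d hd => ?_, ?_⟩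
        · rw [LinearMap.rTensor_tmul, varCoeff_monomial, if_neg fun h => hd (by simp [h]),
            TensorProduct.zero_tmul]
        · rw [Finset.sum_singleton, LinearMap.rTensor_tmul, varCoeff_monomial, if_pos rfl,
            TensorProduct.smul_tmul', smul_eq_mul, monomial_mul, one_mul, add_comm,
            Finsupp.filter_add_filter_not]
      | add r s hr hs =>
        rw [TensorProduct.add_tmul]
        obtain ⟨F, hF, hx⟩ := hr
        obtain ⟨G, hG, hy⟩ := hs
        refine ⟨F ∪ G, fun d hd => ?_, ?_⟩
        · simp only [Finset.mem_union, not_or] at hd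
          rw [map_add, hF d hd.1, hG d hd.2, add_zero]
        · simp only [map_add, smul_add, Finset.sum_add_distrib]
          conv_lhs => rw [hx, hy]
          congr 1
          · exact Finset.sum_subset Finset.subset_union_left fun d _ hd => by
              rw [hF d hd, smul_zero]
          · exact Finset.sum_subset Finset.subset_union_right fun d _ hd => by
              rw [hG d hd, smul_zero]
  · intro g hg d x
    simp only [LinearMap.toAddMonoidHom_coe]
    induction x with
    | zero => simp
    | add x y hx hy => rw [smul_add, map_add, hx, hy, map_add, smul_add]
    | tmul r e =>
      rw [TensorProduct.smul_tmul', smul_eq_mul, LinearMap.rTensor_tmul, varCoeff_mul d hg,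
        LinearMap.rTensor_tmul, TensorProduct.smul_tmul', smul_eq_mul]
  · intro c hc d x
    simp only [LinearMap.toAddMonoidHom_coe]
    induction x with
    | zero => simp
    | add x y hx hy => rw [smul_add, map_add, hx, hy, map_add]; split_ifs <;> simp
    | tmul r e =>
      rw [TensorProduct.smul_tmul', smul_eq_mul, LinearMap.rTensor_tmul,
        varCoeff_monomial_mul hc]
      split_ifs
      · rw [LinearMap.rTensor_tmul]
      · rw [TensorProduct.zero_tmul]

/-- `Q` is graded by the monomials outside any set of variables containing `S`. -/
def IsVarGradedOff {A : Type*} [CommRing A] (S : Set ℕ) (Q : Type*) [AddCommGroup Q]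
    [Module (MvPolynomial ℕ A) Q] : Prop :=
  ∀ T, S ⊆ T → IsVarGraded (A := A) T Q

/-- Dividing by `g` demotes its variables to coefficients; later members of a Kronecker sequence
avoid them, so McCoy's theorem remains available. -/
theorem IsVarGradedOff.quotSMulTop {S : Set ℕ} {Q : Type*} [AddCommGroup Q]
    [Module (MvPolynomial ℕ A) Q] (hQ : IsVarGradedOff (A := A) S Q) (g : MvPolynomial ℕ A) :
    IsVarGradedOff (A := A) (S ∪ g.vars) (QuotSMulTop g Q) := fun T hT =>
  (hQ T (Set.subset_union_left.trans hT)).quotSMulTop (Set.subset_union_right.trans hT)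

theorem isVarGradedOff_tensor (E : Type*) [AddCommGroup E] [Module A E] :
    IsVarGradedOff (A := A) ∅ (MvPolynomial ℕ A ⊗[A] E) := fun T _ => isVarGraded_tensor T E

end ABH

/-! ### Depth in short exact sequences and exchange of Kronecker sequences -/

namespace ABH

open MvPolynomial RingTheory.Sequence
open scoped Pointwise

theorem QuotSMulTop.map_injective_of_isSMulRegular {R : Type*} [CommRing R] {M' M M'' : Type*}
    [AddCommGroup M'] [Module R M'] [AddCommGroup M] [Module R M] [AddCommGroup M'']
    [Module R M''] {i : M' →ₗ[R] M} {q : M →ₗ[R] M''} (hi : Function.Injective i)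
    (hex : Function.Exact i q) {r : R} (hr : IsSMulRegular M'' r) :
    Function.Injective (QuotSMulTop.map r i) := by
  have h0 : Function.Exact (0 : PUnit →ₗ[R] M') i := by
    intro x
    simp [map_eq_zero_iff i hi, eq_comm]
  have h := QuotSMulTop.map_first_exact_on_four_term_exact_of_isSMulRegular_last h0 hex hr
  rw [injective_iff_map_eq_zero]
  intro x hx
  obtain ⟨y, rfl⟩ := (h x).1 hx
  obtain ⟨y, rfl⟩ := Submodule.Quotient.mk_surjective _ y
  simp

theorem isKroneckerSeq_cons {A : Type*} [CommRing A] {a : Ideal A} {f : MvPolynomial ℕ A}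
    {fs : List (MvPolynomial ℕ A)} : IsKroneckerSeq a (f :: fs) ↔
      Ideal.span (Set.range fun d => coeff d f) = a ∧ (∀ g ∈ fs, Disjoint f.vars g.vars) ∧
        IsKroneckerSeq a fs := by
  simp only [IsKroneckerSeq, List.mem_cons, forall_eq_or_imp, List.pairwise_cons]
  tauto

theorem IsWeaklyRegular.of_append_left {R M : Type*} [CommRing R] [AddCommGroup M] [Module R M]
    {rs ss : List R} (h : IsWeaklyRegular M (rs ++ ss)) : IsWeaklyRegular M rs :=
  ((isWeaklyRegular_append_iff M rs ss).1 h).1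

variable {A : Type*} [CommRing A]

/-- In a short exact sequence, the depth of the quotient is at least the minimum of the depth of
the middle term and of the depth of the submodule minus one. -/
theorem isWeaklyRegular_of_shortExact {M' M M'' : Type*} [AddCommGroup M']
    [Module (MvPolynomial ℕ A) M'] [AddCommGroup M] [Module (MvPolynomial ℕ A) M]
    [AddCommGroup M''] [Module (MvPolynomial ℕ A) M''] {i : M' →ₗ[MvPolynomial ℕ A] M}
    {q : M →ₗ[MvPolynomial ℕ A] M''} (hi : Function.Injective i) (hq : Function.Surjective q)
    (hex : Function.Exact i q) {S : Set ℕ} (hS : IsVarGradedOff (A := A) S M'') {a : Ideal A}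
    {fs : List (MvPolynomial ℕ A)} {f : MvPolynomial ℕ A} (hK : IsKroneckerSeq a (fs ++ [f]))
    (hd : ∀ g ∈ fs, ∀ j ∈ g.vars, j ∉ S) (h' : IsWeaklyRegular M' (fs ++ [f]))
    (h : IsWeaklyRegular M fs) : IsWeaklyRegular M'' fs := by
  induction fs generalizing M' M M'' S with
  | nil => exact IsWeaklyRegular.nil _ _
  | cons g gs ih =>
    rw [List.cons_append, isWeaklyRegular_cons_iff] at h'
    rw [isWeaklyRegular_cons_iff] at h
    rw [List.cons_append, isKroneckerSeq_cons] at hK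
    obtain ⟨hga, hgd, hK⟩ := hK
    have hg : IsSMulRegular M'' g := by
      -- By McCoy, it suffices that `e = q x` killed by `a` is zero. Both `g • x` and `f' • x` come
      -- from `M'`, as `y` and `z`, and `f' • y = g • z`. Since `f'` is regular modulo `g`, `y` is a
      -- multiple of `g`; cancelling `g` in `M` puts `x` in the image of `i`.
      refine (hS S le_rfl).isSMulRegular (a := a) (fun e he => ?_) (hd g (by simp)) hga.ge
      obtain ⟨x, rfl⟩ := hq e
      have hmem : ∀ f' : MvPolynomial ℕ A, Ideal.span (Set.range fun d => coeff d f') = a → ∃ y, i y = f' • x := by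
        intro f' hf'
        refine (hex _).1 ?_
        rw [map_smul]
        exact smul_eq_zero_of_coeff hf'.le he
      obtain ⟨f', l, hl⟩ : ∃ f' l, gs ++ [f] = f' :: l := by
        cases gs with
        | nil => exact ⟨_, _, rfl⟩
        | cons b l => exact ⟨_, _, rfl⟩
      rw [hl, isWeaklyRegular_cons_iff] at h'
      rw [hl, isKroneckerSeq_cons] at hK
      obtain ⟨y, hy⟩ := hmem g hga
      obtain ⟨z, hz⟩ := hmem f' hK.1
      have h1 : f' • y = g • z := hi (by rw [map_smul, map_smul, hy, hz, smul_comm])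
      have h2 : y ∈ g • (⊤ : Submodule (MvPolynomial ℕ A) M') :=
        mem_of_isSMulRegular_quotient_of_smul_mem h'.2.1
          (h1 ▸ Submodule.smul_mem_pointwise_smul _ _ _ trivial)
      obtain ⟨y', -, rfl⟩ := (Submodule.mem_smul_pointwise_iff_exists _ _ _).1 h2
      have h3 : i y' = x := h.1 (by simpa using hy)
      exact (hex x).2 ⟨y', h3⟩
    refine (isWeaklyRegular_cons_iff _ _ _).2 ⟨hg, ih
      (QuotSMulTop.map_injective_of_isSMulRegular hi hex hg) (QuotSMulTop.map_surjective g hq)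
      (QuotSMulTop.map_exact g hex hq) (hS.quotSMulTop g) hK ?_ h'.2 h.2⟩
    intro g' hg' j hj hjS
    rcases hjS with hjS | hjS
    · exact hd g' (by simp [hg']) j hj hjS
    · exact Finset.disjoint_left.1 (hgd g' (by simp [hg'])) hjS hj

/-- Regularity of a Kronecker sequence only depends on its length, and it is inherited by larger
ideals. -/
theorem IsWeaklyRegular.of_isKroneckerSeq {Q : Type*} [AddCommGroup Q]
    [Module (MvPolynomial ℕ A) Q] {S : Set ℕ} (hS : IsVarGradedOff (A := A) S Q) {a b : Ideal A}
    (hab : a ≤ b) {fs gs : List (MvPolynomial ℕ A)} (hlen : fs.length = gs.length)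
    (hfs : IsKroneckerSeq a fs) (hgs : IsKroneckerSeq b gs)
    (hd : ∀ f ∈ fs, ∀ g ∈ gs, Disjoint f.vars g.vars) (hfS : ∀ f ∈ fs, ∀ j ∈ f.vars, j ∉ S)
    (hgS : ∀ g ∈ gs, ∀ j ∈ g.vars, j ∉ S) (h : IsWeaklyRegular Q fs) : IsWeaklyRegular Q gs := by
  induction gs generalizing Q S fs with
  | nil => exact IsWeaklyRegular.nil _ _
  | cons g gs ih =>
    rw [isKroneckerSeq_cons] at hgs
    have hg : IsSMulRegular Q g := by
      obtain _ | ⟨f, fs⟩ := fs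
      · simp at hlen
      rw [isKroneckerSeq_cons] at hfs
      rw [isWeaklyRegular_cons_iff] at h
      refine (hS S le_rfl).isSMulRegular (a := b) ?_ (hgS g (by simp)) hgs.1.ge
      exact TorsionFreeAt.of_isSMulRegular (hfs.1.trans_le hab) h.1
    have hne : fs ≠ [] := by
      rintro rfl
      simp at hlen
    -- The last `f` is sacrificed: in `0 → Q → Q → Q/gQ → 0`, with first map multiplication by `g`,
    -- the quotient keeps regularity of `l`, which is as long as the tail of the new sequence.
    obtain ⟨l, f, rfl⟩ : ∃ l f, fs = l ++ [f] :=
      ⟨_, _, (List.dropLast_append_getLast hne).symm⟩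
    have hex : Function.Exact (LinearMap.lsmul (MvPolynomial ℕ A) Q g)
        (g • (⊤ : Submodule (MvPolynomial ℕ A) Q)).mkQ := by
      intro x
      rw [Submodule.mkQ_apply, Submodule.Quotient.mk_eq_zero,
        Submodule.mem_smul_pointwise_iff_exists]
      simp
    refine (isWeaklyRegular_cons_iff _ _ _).2 ⟨hg, ih (fs := l) (hS.quotSMulTop g) ?_ ?_ hgs.2.2
      (fun f' hf' g' hg' => hd f' (by simp [hf']) g' (by simp [hg'])) ?_ ?_ ?_⟩
    · simpa using hlen
    · exact ⟨fun f' hf' => hfs.1 f' (by simp [hf']), hfs.2.sublist (by simp)⟩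
    · rintro f' hf' j hj (hjS | hjS)
      · exact hfS f' (by simp [hf']) j hj hjS
      · exact Finset.disjoint_left.1 (hd f' (by simp [hf']) g (by simp)) hj hjS
    · rintro g' hg' j hj (hjS | hjS)
      · exact hgS g' (by simp [hg']) j hj hjS
      · exact Finset.disjoint_left.1 (hgs.2.1 g' hg') hjS hj
    · refine isWeaklyRegular_of_shortExact (i := LinearMap.lsmul (MvPolynomial ℕ A) Q g)
        (hS := hS.quotSMulTop g) hg (Submodule.mkQ_surjective _)
        hex hfs ?_ h (IsWeaklyRegular.of_append_left h)
      rintro f' hf' j hj (hjS | hjS)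
      · exact hfS f' (by simp [hf']) j hj hjS
      · exact Finset.disjoint_left.1 (hd f' (by simp [hf']) g (by simp)) hj hjS

/-- Kronecker's polynomial `∑ c_j X_i^j` on generators `c_j` of `a`. -/
theorem exists_span_coeff_eq {a : Ideal A} (ha : a.FG) (i : ℕ) : ∃ f : MvPolynomial ℕ A,
    f.vars ⊆ {i} ∧ Ideal.span (Set.range fun d => coeff d f) = a := by
  classical
  obtain ⟨n, c, rfl⟩ := Submodule.fg_iff_exists_fin_generating_family.1 ha
  have hcoeff : ∀ d, coeff d (∑ j : Fin n, monomial (Finsupp.single i (j : ℕ)) (c j)) =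
      ∑ j : Fin n, if Finsupp.single i (j : ℕ) = d then c j else 0 := by
    intro d
    simp [coeff_sum, coeff_monomial]
  refine ⟨∑ j : Fin n, monomial (Finsupp.single i (j : ℕ)) (c j), ?_, le_antisymm ?_ ?_⟩
  · refine (vars_sum_subset _ _).trans ?_
    refine Finset.biUnion_subset.2 fun j _ => ?_
    intro k hk
    rw [mem_vars_iff_mem_support] at hk
    obtain ⟨d, hd, hk⟩ := hk
    obtain rfl := Finset.mem_singleton.1 (support_monomial_subset hd)
    exact Finsupp.support_single_subset hk
  · rw [Ideal.span_le]
    rintro _ ⟨d, rfl⟩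
    simp only [hcoeff]
    refine Submodule.sum_mem _ fun j _ => ?_
    split_ifs
    · exact Submodule.subset_span ⟨j, rfl⟩
    · exact Submodule.zero_mem _
  · refine Submodule.span_le.2 ?_
    rintro _ ⟨j, rfl⟩
    refine Ideal.subset_span ⟨Finsupp.single i (j : ℕ), ?_⟩
    simp only [hcoeff]
    rw [Finset.sum_eq_single j]
    · simp
    · intro k _ hk
      rw [if_neg]
      intro h
      exact hk (Fin.ext (Finsupp.single_injective i h))
    · simp

/-- A Kronecker sequence can be chosen of any length and with variables outside a finite set. -/
theorem exists_isKroneckerSeq {a : Ideal A} (ha : a.FG) (n N : ℕ) :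
    ∃ fs : List (MvPolynomial ℕ A), fs.length = n ∧ IsKroneckerSeq a fs ∧
      ∀ f ∈ fs, ∀ j ∈ f.vars, N ≤ j := by
  induction n generalizing N with
  | zero => exact ⟨[], rfl, ⟨by simp, List.Pairwise.nil⟩, by simp⟩
  | succ n ih =>
    obtain ⟨fs, hlen, hK, hN⟩ := ih (N + 1)
    obtain ⟨f, hf, hfa⟩ := exists_span_coeff_eq ha N
    have hfv : ∀ j ∈ f.vars, j = N := fun j hj => Finset.mem_singleton.1 (hf hj)
    refine ⟨f :: fs, by simp [hlen], isKroneckerSeq_cons.2 ⟨hfa, fun g hg => ?_, hK⟩, ?_⟩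
    · rw [Finset.disjoint_left]
      intro j hj hj'
      have := hN g hg j hj'
      have := hfv j hj
      omega
    · simp only [List.mem_cons, forall_eq_or_imp]
      exact ⟨fun j hj => (hfv j hj).ge, fun g hg j hj => (hN g hg j hj).trans' (by omega)⟩

theorem exists_vars_lt (fs : List (MvPolynomial ℕ A)) : ∃ N, ∀ f ∈ fs, ∀ j ∈ f.vars, j < N := by
  induction fs with
  | nil => exact ⟨0, by simp⟩
  | cons f fs ih =>
    obtain ⟨N, hN⟩ := ih
    refine ⟨max N (f.vars.sup id + 1), ?_⟩
    simp only [List.mem_cons, forall_eq_or_imp, lt_max_iff]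
    exact ⟨fun j hj => Or.inr (Nat.lt_succ_of_le (Finset.le_sup (f := id) hj)),
      fun g hg j hj => Or.inl (hN g hg j hj)⟩

/-- The exchange lemma needs the two sequences to have disjoint variables, so the new one is built
beyond every variable of the old one. -/
theorem GradeGE.mono {a b : Ideal A} (hb : b.FG) (hab : a ≤ b) {E : Type*} [AddCommGroup E]
    [Module A E] {k : ℕ} (h : GradeGE a E k) : GradeGE b E k := by
  obtain ⟨fs, hlen, hK, hreg⟩ := h
  obtain ⟨N, hN⟩ := exists_vars_lt fs
  obtain ⟨gs, hlen', hK', hN'⟩ := exists_isKroneckerSeq hb k N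
  refine ⟨gs, hlen', hK', IsWeaklyRegular.of_isKroneckerSeq (isVarGradedOff_tensor E) hab
    (hlen.trans hlen'.symm) hK hK' (fun f hf g hg => ?_) (by simp) (by simp) hreg⟩
  rw [Finset.disjoint_left]
  intro j hj hj'
  exact absurd (hN f hf j hj) (not_lt.2 (hN' g hg j hj'))

theorem gradeGE_zero {a : Ideal A} (E : Type*) [AddCommGroup E] [Module A E] : GradeGE a E 0 :=
  ⟨[], rfl, ⟨by simp, List.Pairwise.nil⟩, IsWeaklyRegular.nil _ _⟩

/-- A Kronecker sequence can be extended to any larger length. -/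
theorem IsKroneckerSeq.exists_append {a : Ideal A} (ha : a.FG) {fs : List (MvPolynomial ℕ A)}
    (hfs : IsKroneckerSeq a fs) (n : ℕ) :
    ∃ gs : List (MvPolynomial ℕ A), gs.length = n ∧ IsKroneckerSeq a (fs ++ gs) := by
  obtain ⟨N, hN⟩ := exists_vars_lt fs
  obtain ⟨gs, hlen, hK, hN'⟩ := exists_isKroneckerSeq ha n N
  refine ⟨gs, hlen, ?_, List.pairwise_append.2 ⟨hfs.2, hK.2, fun f hf g hg => ?_⟩⟩
  · intro f hf
    rcases List.mem_append.1 hf with hf | hf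
    · exact hfs.1 f hf
    · exact hK.1 f hf
  · rw [Finset.disjoint_left]
    intro j hj hj'
    exact absurd (hN f hf j hj) (not_lt.2 (hN' g hg j hj'))

end ABH

/-! ### Direct summands, free modules and flat base change to `A[X]` -/

namespace ABH

open MvPolynomial RingTheory.Sequence
open scoped Pointwise

theorem IsWeaklyRegular.of_leftInverse {R : Type*} [CommRing R] {M N : Type*} [AddCommGroup M]
    [Module R M] [AddCommGroup N] [Module R N] (s : N →ₗ[R] M) (r : M →ₗ[R] N)
    (h : r ∘ₗ s = LinearMap.id) {rs : List R} (hM : IsWeaklyRegular M rs) :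
    IsWeaklyRegular N rs := by
  induction rs generalizing M N with
  | nil => exact IsWeaklyRegular.nil _ _
  | cons x xs ih =>
    rw [isWeaklyRegular_cons_iff] at hM ⊢
    refine ⟨hM.1.of_injective s (Function.LeftInverse.injective (LinearMap.congr_fun h)),
      ih (QuotSMulTop.map x s) (QuotSMulTop.map x r) ?_ hM.2⟩
    rw [← QuotSMulTop.map_comp, h, QuotSMulTop.map_id]

section

variable {A : Type*} [CommRing A]

theorem IsWeaklyRegular.tensor_of_leftInverse {M N : Type*} [AddCommGroup M] [Module A M]
    [AddCommGroup N] [Module A N] (s : N →ₗ[A] M) (r : M →ₗ[A] N) (h : r ∘ₗ s = LinearMap.id)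
    {fs : List (MvPolynomial ℕ A)} (hM : IsWeaklyRegular (MvPolynomial ℕ A ⊗[A] M) fs) :
    IsWeaklyRegular (MvPolynomial ℕ A ⊗[A] N) fs :=
  IsWeaklyRegular.of_leftInverse (s.baseChange _) (r.baseChange _)
    (by rw [← LinearMap.baseChange_comp, h, LinearMap.baseChange_id]) hM

/-- `A[X] ⊗ M` is free, hence flat, over `A[X]`, and tensoring with a flat module preserves weak
regularity. -/
theorem IsWeaklyRegular.tensor_free {M : Type*} [AddCommGroup M] [Module A M] [Module.Free A M]
    {fs : List (MvPolynomial ℕ A)} (h : IsWeaklyRegular (MvPolynomial ℕ A ⊗[A] A) fs) :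
    IsWeaklyRegular (MvPolynomial ℕ A ⊗[A] M) fs := by
  rw [(TensorProduct.AlgebraTensorModule.rid A (MvPolynomial ℕ A)
    (MvPolynomial ℕ A)).isWeaklyRegular_congr] at h
  have := h.isWeaklyRegular_rTensor (M₂ := MvPolynomial ℕ A ⊗[A] M)
  rwa [(TensorProduct.lid (MvPolynomial ℕ A) _).isWeaklyRegular_congr] at this

/-- A nonzero free module has `A` as a direct summand. The conditional hypothesis lets the zero ring
through, where zero maps suffice. -/
theorem exists_leftInverse_of_free {M : Type*} [AddCommGroup M] [Module A M] [Module.Free A M]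
    (h : Nontrivial A → Nontrivial M) :
    ∃ (s : A →ₗ[A] M) (r : M →ₗ[A] A), r ∘ₗ s = LinearMap.id := by
  cases subsingleton_or_nontrivial A with
  | inl hA => exact ⟨0, 0, LinearMap.ext fun x => Subsingleton.elim _ _⟩
  | inr hA =>
    have := h hA
    let b := Module.Free.chooseBasis A M
    obtain ⟨i⟩ := b.index_nonempty
    exact ⟨LinearMap.toSpanSingleton A M (b i), b.coord i, by ext; simp⟩

theorem IsWeaklyRegular.of_tensor_free {M : Type*} [AddCommGroup M] [Module A M] [Module.Free A M]
    (hM : Nontrivial A → Nontrivial M) {fs : List (MvPolynomial ℕ A)}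
    (h : IsWeaklyRegular (MvPolynomial ℕ A ⊗[A] M) fs) :
    IsWeaklyRegular (MvPolynomial ℕ A ⊗[A] A) fs := by
  obtain ⟨s, r, hsr⟩ := exists_leftInverse_of_free hM
  exact IsWeaklyRegular.tensor_of_leftInverse s r hsr h

theorem exact_baseChange {M N P : Type*} [AddCommGroup M] [Module A M] [AddCommGroup N]
    [Module A N] [AddCommGroup P] [Module A P] {f : M →ₗ[A] N} {g : N →ₗ[A] P}
    (h : Function.Exact f g) : Function.Exact (f.baseChange (MvPolynomial ℕ A))
      (g.baseChange (MvPolynomial ℕ A)) := by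
  have := Module.Flat.lTensor_exact (MvPolynomial ℕ A) h
  rwa [← LinearMap.baseChange_eq_ltensor, ← LinearMap.baseChange_eq_ltensor] at this

theorem injective_baseChange {M N : Type*} [AddCommGroup M] [Module A M] [AddCommGroup N]
    [Module A N] {f : M →ₗ[A] N} (h : Function.Injective f) :
    Function.Injective (f.baseChange (MvPolynomial ℕ A)) := by
  rw [LinearMap.baseChange_eq_ltensor]
  exact Module.Flat.lTensor_preserves_injective_linearMap f h

theorem surjective_baseChange {M N : Type*} [AddCommGroup M] [Module A M] [AddCommGroup N]
    [Module A N] {f : M →ₗ[A] N} (h : Function.Surjective f) :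
    Function.Surjective (f.baseChange (MvPolynomial ℕ A)) := by
  rw [LinearMap.baseChange_eq_ltensor]
  exact LinearMap.lTensor_surjective _ h

end

/-! ### Syzygies and the direct part -/

section Resolution

variable {A : Type u} [CommRing A] {E : Type v} [AddCommGroup E] [Module A E] {L : ℕ → Type w}
  [∀ j, AddCommGroup (L j)] [∀ j, Module A (L j)] {m : ℕ} {u : ∀ j, L (j + 1) →ₗ[A] L j}
  {π : L 0 →ₗ[A] E}

/-- The module resolved by `L` can be moved to the universe of `L`. -/
theorem IsResolution.quotKer (hres : IsResolution m u π) :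
    IsResolution m u (LinearMap.ker π).mkQ :=
  ⟨hres.subsingleton, hres.exact_succ, fun x => by
    rw [← hres.exact_zero x, Submodule.mkQ_apply, Submodule.Quotient.mk_eq_zero,
      LinearMap.mem_ker], Submodule.mkQ_surjective _⟩

theorem IsResolution.bijective (hres : IsResolution 0 u π) : Function.Bijective π := by
  refine ⟨?_, hres.surjective⟩
  have := hres.subsingleton 1 one_pos
  rw [injective_iff_map_eq_zero]
  intro x hx
  obtain ⟨y, rfl⟩ := (hres.exact_zero x).1 hx
  rw [Subsingleton.elim y 0, map_zero]

/-- A resolution of the first syzygy module. -/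
theorem IsResolution.ker (hres : IsResolution (m + 1) u π) :
    IsResolution (L := fun j => L (j + 1)) m (fun j => u (j + 1))
      ((u 0).codRestrict (LinearMap.ker π) fun x => (hres.exact_zero _).2 ⟨x, rfl⟩) := by
  refine ⟨fun j hj => hres.subsingleton (j + 1) (by omega), fun j => hres.exact_succ (j + 1),
    fun x => ?_, ?_⟩
  · rw [← hres.exact_succ 0 x, ← (LinearMap.ker π).coe_eq_zero]
    rfl
  · rintro ⟨x, hx⟩
    obtain ⟨y, rfl⟩ := (hres.exact_zero x).1 hx
    exact ⟨y, rfl⟩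

end Resolution

/-- The depth of a module with a finite free resolution of length `m` drops by at most `m`. -/
theorem isWeaklyRegular_of_isResolution {A : Type u} [CommRing A] {E : Type w} [AddCommGroup E]
    [Module A E] {L : ℕ → Type w} [∀ j, AddCommGroup (L j)] [∀ j, Module A (L j)]
    [∀ j, Module.Free A (L j)] {m : ℕ} {u : ∀ j, L (j + 1) →ₗ[A] L j} {π : L 0 →ₗ[A] E}
    (hres : IsResolution m u π) {a : Ideal A} {fs gs : List (MvPolynomial ℕ A)}
    (hlen : gs.length = m) (hK : IsKroneckerSeq a (fs ++ gs))
    (h : IsWeaklyRegular (MvPolynomial ℕ A ⊗[A] A) (fs ++ gs)) :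
    IsWeaklyRegular (MvPolynomial ℕ A ⊗[A] E) fs := by
  induction m generalizing E L fs gs with
  | zero =>
    let e := LinearEquiv.ofBijective π hres.bijective
    refine IsWeaklyRegular.tensor_of_leftInverse e.symm.toLinearMap π ?_
      (IsWeaklyRegular.tensor_free (M := L 0) (IsWeaklyRegular.of_append_left h))
    ext x
    exact e.apply_symm_apply x
  | succ m ih =>
    obtain _ | ⟨g, gs⟩ := gs
    · simp at hlen
    rw [List.append_cons] at hK h
    -- The first syzygy has a resolution shorter by one, so it supports one more polynomial than
    -- `E`: exactly the one lost in `0 → ker π → L 0 → E → 0`.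
    have h1 := ih (fs := fs ++ [g]) (gs := gs) hres.ker (by simpa using hlen) hK h
    have hK' : IsKroneckerSeq a (fs ++ [g]) :=
      ⟨fun f hf => hK.1 f (List.mem_append_left _ hf), hK.2.sublist (List.sublist_append_left _ _)⟩
    exact isWeaklyRegular_of_shortExact
      (injective_baseChange (LinearMap.ker π).injective_subtype)
      (surjective_baseChange hres.surjective)
      (exact_baseChange (LinearMap.exact_subtype_ker_map π)) (isVarGradedOff_tensor E) hK' (by simp)
      h1 (IsWeaklyRegular.tensor_free
        (IsWeaklyRegular.of_append_left (IsWeaklyRegular.of_append_left h)))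

/-! ### Regularity along an exact complex whose last map has entries in the ideal -/

section Converse

variable {A : Type*} [CommRing A]

/-- A map in `𝔞 • Hom` kills whatever 𝔞 kills, and `d` is injective because `P = 0`. -/
theorem torsionFreeAt_of_mem_smul {a : Ideal A} {M N P : Type*} [AddCommGroup M]
    [Module (MvPolynomial ℕ A) M] [AddCommGroup N] [Module (MvPolynomial ℕ A) N]
    [AddCommGroup P] [Module (MvPolynomial ℕ A) P] [Subsingleton P]
    {e : P →ₗ[MvPolynomial ℕ A] M} {d : M →ₗ[MvPolynomial ℕ A] N}
    (hex : Function.Exact e d)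
    (hd : d ∈ a.map (C : A →+* MvPolynomial ℕ A) • (⊤ : Submodule (MvPolynomial ℕ A)
      (M →ₗ[MvPolynomial ℕ A] N))) : TorsionFreeAt a M := by
  intro x hx
  have hx' : ∀ r ∈ a.map (C : A →+* MvPolynomial ℕ A), r • x = 0 := by
    have : a.map (C : A →+* MvPolynomial ℕ A) ≤
        LinearMap.ker (LinearMap.toSpanSingleton (MvPolynomial ℕ A) M x) := by
      rw [Ideal.map_le_iff_le_comap]
      intro c hc
      simpa using hx c hc
    intro r hr
    simpa using this hr
  have hdx : d x = 0 := by
    have h : a.map (C : A →+* MvPolynomial ℕ A) • (⊤ : Submodule (MvPolynomial ℕ A)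
        (M →ₗ[MvPolynomial ℕ A] N)) ≤ LinearMap.ker (LinearMap.applyₗ x) :=
      Submodule.smul_le.2 fun r hr φ _ => by
        rw [LinearMap.mem_ker, LinearMap.applyₗ_apply_apply, LinearMap.smul_apply, ← map_smul,
          hx' r hr, map_zero]
    exact h hd
  obtain ⟨y, rfl⟩ := (hex x).1 hdx
  rw [Subsingleton.elim y 0, map_zero]

/-- Membership in `I • Hom` replaces the condition on matrix entries because it survives division by
`r`, after which the modules need not be free over `R`. -/
theorem map_mem_smul_top {R : Type*} [CommRing R] {I : Ideal R} {M N : Type*} [AddCommGroup M]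
    [Module R M] [AddCommGroup N] [Module R N] (r : R) {d : M →ₗ[R] N}
    (hd : d ∈ I • (⊤ : Submodule R (M →ₗ[R] N))) : QuotSMulTop.map r d ∈
      I • (⊤ : Submodule R (QuotSMulTop r M →ₗ[R] QuotSMulTop r N)) := by
  have := Submodule.mem_map_of_mem (f := QuotSMulTop.map r) hd
  rw [Submodule.map_smul''] at this
  exact Submodule.smul_mono le_rfl le_top this

/-- Each polynomial is regular on the leftmost term, hence on all terms by `hreg`; division by it
preserves exactness except at the right end, so the complex is shortened by one. The hypothesis
`hreg` stands for "free of positive rank" in a form that passes to quotients. -/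
theorem isWeaklyRegular_of_exact {M : ℕ → Type*} [∀ j, AddCommGroup (M j)]
    [∀ j, Module (MvPolynomial ℕ A) (M j)] {d : ∀ j, M (j + 1) →ₗ[MvPolynomial ℕ A] M j}
    (hex : ∀ j, Function.Exact (d (j + 1)) (d j)) {m : ℕ} (hm : Subsingleton (M (m + 1)))
    (hreg : ∀ j (rs : List (MvPolynomial ℕ A)),
      IsWeaklyRegular (M m) rs → IsWeaklyRegular (M j) rs) {a : Ideal A}
    (hd : ∀ j, j + 1 = m → d j ∈ a.map (C : A →+* MvPolynomial ℕ A) • (⊤ : Submodule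
      (MvPolynomial ℕ A) (M (j + 1) →ₗ[MvPolynomial ℕ A] M j)))
    {S : Set ℕ} (hS : IsVarGradedOff (A := A) S (M m)) {gs : List (MvPolynomial ℕ A)}
    (hlen : gs.length = m) (hK : IsKroneckerSeq a gs) (hgS : ∀ g ∈ gs, ∀ j ∈ g.vars, j ∉ S) :
    IsWeaklyRegular (M m) gs := by
  induction gs generalizing M m S with
  | nil => exact IsWeaklyRegular.nil _ _
  | cons g gs ih =>
    obtain ⟨n, rfl⟩ : ∃ n, m = n + 1 := ⟨_, hlen.symm⟩
    rw [isKroneckerSeq_cons] at hK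
    have hg : IsSMulRegular (M (n + 1)) g :=
      (hS S le_rfl).isSMulRegular (torsionFreeAt_of_mem_smul (hex n) (hd n rfl))
        (hgS g (by simp)) hK.1.ge
    have hgj : ∀ j, IsSMulRegular (M j) g := fun j =>
      (isWeaklyRegular_singleton_iff _ _).1
        (hreg j [g] ((isWeaklyRegular_singleton_iff _ _).2 hg))
    -- The shift `j + 1` discards the rightmost term: exactness at the reduction of `M (j + 2)` uses
    -- regularity of `g` on `M j`, two places to the right of the source term.
    refine (isWeaklyRegular_cons_iff _ _ _).2 ⟨hg, ih (M := fun j => QuotSMulTop g (M (j + 1)))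
      (d := fun j => QuotSMulTop.map g (d (j + 1))) (fun j => ?_) ?_ (fun j rs h => ?_)
      (fun j hj => ?_) (hS.quotSMulTop g) (by simpa using hlen) hK.2.2 ?_⟩
    · exact QuotSMulTop.map_first_exact_on_four_term_exact_of_isSMulRegular_last (hex (j + 1))
        (hex j) (hgj j)
    · exact (Submodule.mkQ_surjective _).subsingleton
    · exact ((isWeaklyRegular_cons_iff _ _ _).1
        (hreg (j + 1) (g :: rs) ((isWeaklyRegular_cons_iff _ _ _).2 ⟨hg, h⟩))).2
    · exact map_mem_smul_top g (hd (j + 1) (by omega))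
    · rintro g' hg' j hj (hjS | hjS)
      · exact hgS g' (by simp [hg']) j hj hjS
      · exact Finset.disjoint_left.1 (hK.2.1 g' hg') hjS hj

/-- While the polynomials are regular on `E`, reduction keeps exactness at `M 0` as well as at the
later terms, so no degree is lost until `fs` is exhausted. -/
theorem isWeaklyRegular_append_of_exact {M : ℕ → Type*} [∀ j, AddCommGroup (M j)]
    [∀ j, Module (MvPolynomial ℕ A) (M j)] {d : ∀ j, M (j + 1) →ₗ[MvPolynomial ℕ A] M j}
    (hex : ∀ j, Function.Exact (d (j + 1)) (d j)) {n : ℕ} (hm : Subsingleton (M (n + 2)))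
    (hreg : ∀ j (rs : List (MvPolynomial ℕ A)),
      IsWeaklyRegular (M (n + 1)) rs → IsWeaklyRegular (M j) rs) {a : Ideal A}
    (hd : d n ∈ a.map (C : A →+* MvPolynomial ℕ A) • (⊤ : Submodule
      (MvPolynomial ℕ A) (M (n + 1) →ₗ[MvPolynomial ℕ A] M n)))
    {E : Type*} [AddCommGroup E] [Module (MvPolynomial ℕ A) E] {q : M 0 →ₗ[MvPolynomial ℕ A] E}
    (hq : Function.Surjective q) (hexq : Function.Exact (d 0) q)
    {S : Set ℕ} (hS : IsVarGradedOff (A := A) S (M (n + 1))) {fs gs : List (MvPolynomial ℕ A)}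
    (hlen : gs.length = n + 1) (hK : IsKroneckerSeq a (fs ++ gs))
    (hgS : ∀ g ∈ fs ++ gs, ∀ j ∈ g.vars, j ∉ S) (hE : IsWeaklyRegular E fs) :
    IsWeaklyRegular (M (n + 1)) (fs ++ gs) := by
  induction fs generalizing M E S with
  | nil =>
    refine isWeaklyRegular_of_exact hex hm hreg (fun j hj => ?_) hS hlen hK hgS
    obtain rfl : j = n := by omega
    exact hd
  | cons f fs ih =>
    rw [List.cons_append] at hK ⊢
    rw [isKroneckerSeq_cons] at hK
    rw [isWeaklyRegular_cons_iff] at hE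
    have hf : IsSMulRegular (M (n + 1)) f :=
      (hS S le_rfl).isSMulRegular (torsionFreeAt_of_mem_smul (hex n) hd)
        (hgS f (by simp)) hK.1.ge
    have hfj : ∀ j, IsSMulRegular (M j) f := fun j =>
      (isWeaklyRegular_singleton_iff _ _).1
        (hreg j [f] ((isWeaklyRegular_singleton_iff _ _).2 hf))
    refine (isWeaklyRegular_cons_iff _ _ _).2 ⟨hf, ih (M := fun j => QuotSMulTop f (M j))
      (d := fun j => QuotSMulTop.map f (d j)) (fun j => ?_) ?_ (fun j rs h => ?_)
      (map_mem_smul_top f hd) (QuotSMulTop.map_surjective f hq) (QuotSMulTop.map_exact f hexq hq)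
      (hS.quotSMulTop f) hK.2.2 ?_ hE.2⟩
    · cases j with
      | zero =>
        exact QuotSMulTop.map_first_exact_on_four_term_exact_of_isSMulRegular_last (hex 0)
          hexq hE.1
      | succ j =>
        exact QuotSMulTop.map_first_exact_on_four_term_exact_of_isSMulRegular_last
          (hex (j + 1)) (hex j) (hfj j)
    · exact (Submodule.mkQ_surjective _).subsingleton
    · exact ((isWeaklyRegular_cons_iff _ _ _).1
        (hreg j (f :: rs) ((isWeaklyRegular_cons_iff _ _ _).2 ⟨hf, h⟩))).2
    · rintro g' hg' j hj (hjS | hjS)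
      · exact hgS g' (List.mem_cons_of_mem _ hg') j hj hjS
      · exact Finset.disjoint_left.1 (hK.2.1 g' hg') hjS hj

theorem mem_smul_top_of_detIdealOne_le {a : Ideal A} {M N : Type*} [AddCommGroup M] [Module A M]
    [AddCommGroup N] [Module A N] [Module.Free A M] [Module.Finite A M] [Module.Free A N]
    [Module.Finite A N] {f : M →ₗ[A] N} (h : detIdealOne f ≤ a) :
    f ∈ a • (⊤ : Submodule A (M →ₗ[A] N)) := by
  let b := Module.Free.chooseBasis A M
  let c := Module.Free.chooseBasis A N
  have hf : f = ∑ i, ∑ j, c.coord j (f (b i)) •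
      (LinearMap.toSpanSingleton A N (c j) ∘ₗ b.coord i) := by
    refine b.ext fun k => ?_
    simp only [LinearMap.sum_apply, LinearMap.smul_apply, LinearMap.comp_apply,
      Module.Basis.coord_apply, LinearMap.toSpanSingleton_apply, Module.Basis.repr_self]
    rw [Finset.sum_eq_single k]
    · simp [c.sum_repr]
    · intro i _ hi
      simp [Finsupp.single_eq_of_ne hi]
    · simp
  rw [hf]
  exact Submodule.sum_mem _ fun i _ => Submodule.sum_mem _ fun j _ =>
    Submodule.smul_mem_smul (h (Ideal.subset_span ⟨b i, c.coord j, rfl⟩)) trivial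

theorem baseChange_mem_smul_top {a : Ideal A} {M N : Type*} [AddCommGroup M] [Module A M]
    [AddCommGroup N] [Module A N] {f : M →ₗ[A] N} (h : f ∈ a • (⊤ : Submodule A (M →ₗ[A] N))) :
    f.baseChange (MvPolynomial ℕ A) ∈ a.map (C : A →+* MvPolynomial ℕ A) •
      (⊤ : Submodule (MvPolynomial ℕ A) (MvPolynomial ℕ A ⊗[A] M →ₗ[MvPolynomial ℕ A]
        MvPolynomial ℕ A ⊗[A] N)) := by
  induction h using Submodule.smul_induction_on' with
  | smul r hr φ _ =>
    rw [LinearMap.baseChange_smul, ← algebraMap_smul (MvPolynomial ℕ A) r]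
    exact Submodule.smul_mem_smul (Ideal.mem_map_of_mem _ hr) trivial
  | add φ _ ψ _ h1 h2 =>
    rw [LinearMap.baseChange_add]
    exact Submodule.add_mem _ h1 h2

end Converse

/-! ### Grade inequalities for a resolution -/

section Resolution

variable {A : Type u} [CommRing A] {E : Type v} [AddCommGroup E] [Module A E] {L : ℕ → Type w}
  [∀ j, AddCommGroup (L j)] [∀ j, Module A (L j)] {m : ℕ} {u : ∀ j, L (j + 1) →ₗ[A] L j}
  {π : L 0 →ₗ[A] E}

theorem IsResolution.gradeGE [∀ j, Module.Free A (L j)] (hres : IsResolution m u π) {k : ℕ}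
    {a : Ideal A} (h : GradeGE a A (k + m)) : GradeGE a E k := by
  obtain ⟨l, hlen, hK, hreg⟩ := h
  rw [← List.take_append_drop k l] at hK hreg
  let e := π.quotKerEquivOfSurjective hres.surjective
  refine ⟨l.take k, by simp [hlen], ⟨fun f hf => hK.1 f (List.mem_append_left _ hf),
    hK.2.sublist (List.sublist_append_left _ _)⟩, IsWeaklyRegular.tensor_of_leftInverse
      e.symm.toLinearMap e.toLinearMap (by ext; simp)
      (isWeaklyRegular_of_isResolution hres.quotKer (by simp [hlen]) hK hreg)⟩

theorem IsResolution.gradeGE_ring [∀ j, Module.Free A (L j)] [∀ j, Module.Finite A (L j)]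
    (hres : IsResolution m u π) (hL : Nontrivial A → Nontrivial (L m)) {k : ℕ} {a : Ideal A}
    (ha : a.FG) (hu : 1 ≤ m → detIdealOne (u (m - 1)) ≤ a) (h : GradeGE a E k) :
    GradeGE a A (k + m) := by
  obtain ⟨fs, hlen, hK, hreg⟩ := h
  cases m with
  | zero =>
    let e := LinearEquiv.ofBijective π hres.bijective
    exact ⟨fs, hlen, hK, IsWeaklyRegular.of_tensor_free hL
      (IsWeaklyRegular.tensor_of_leftInverse e.toLinearMap e.symm.toLinearMap (by ext; simp) hreg)⟩
  | succ n =>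
    obtain ⟨gs, hlen', hK'⟩ := hK.exists_append ha (n + 1)
    have := hres.subsingleton (n + 2) (by omega)
    refine ⟨fs ++ gs, by simp [hlen, hlen'], hK', IsWeaklyRegular.of_tensor_free hL
      (isWeaklyRegular_append_of_exact (M := fun j => MvPolynomial ℕ A ⊗[A] L j)
        (d := fun j => (u j).baseChange _) (fun j => exact_baseChange (hres.exact_succ j)) ?_
        (fun j rs h => IsWeaklyRegular.tensor_free (IsWeaklyRegular.of_tensor_free hL h))
        (baseChange_mem_smul_top (mem_smul_top_of_detIdealOne_le (hu (by omega))))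
        (surjective_baseChange hres.surjective) (exact_baseChange hres.exact_zero)
        (isVarGradedOff_tensor _) hlen' hK' (by simp) hreg)⟩
    infer_instance

end Resolution

end ABH

/-! ### Projective dimension of a minimal resolution -/

namespace ABH

section ProjectiveDimension

variable {A : Type u} [CommRing A]

theorem hasProjectiveDimensionLT_of_isResolution {E : Type u} [AddCommGroup E] [Module A E]
    {P : ℕ → Type u} [∀ j, AddCommGroup (P j)] [∀ j, Module A (P j)]
    [∀ j, Module.Projective A (P j)] {n : ℕ} {u : ∀ j, P (j + 1) →ₗ[A] P j} {π : P 0 →ₗ[A] E}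
    (hres : IsResolution n u π) :
    CategoryTheory.HasProjectiveDimensionLT (ModuleCat.of A E) (n + 1) := by
  induction n generalizing E P with
  | zero =>
    rw [zero_add, ← CategoryTheory.projective_iff_hasProjectiveDimensionLT_one,
      ← IsProjective.iff_projective]
    exact Module.Projective.of_equiv (LinearEquiv.ofBijective π hres.bijective)
  | succ n ih =>
    have hP : CategoryTheory.Projective π.shortComplexKer.X₂ :=
      (IsProjective.iff_projective (P 0)).1 inferInstance
    exact ((LinearMap.shortExact_shortComplexKer hres.surjective).hasProjectiveDimensionLT_X₃_iff n
      hP).2 (ih hres.ker)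

theorem IsMinimal.mem_smul_top [IsLocalRing A] {L : ℕ → Type w} [∀ j, AddCommGroup (L j)]
    [∀ j, Module A (L j)] [∀ j, Module.Free A (L j)] [∀ j, Module.Finite A (L j)]
    {u : ∀ j, L (j + 1) →ₗ[A] L j} (hu : IsMinimal u) (j : ℕ) :
    u j ∈ (⊥ : Ideal A).jacobson • (⊤ : Submodule A (L (j + 1) →ₗ[A] L j)) :=
  mem_smul_top_of_detIdealOne_le (hu j)

/-- Nakayama's lemma for a map that has a left inverse. -/
theorem subsingleton_of_leftInverse_of_mem_smul {M N : Type*} [AddCommGroup M] [Module A M]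
    [Module.Finite A M] [AddCommGroup N] [Module A N] {f : M →ₗ[A] N}
    (hf : f ∈ (⊥ : Ideal A).jacobson • (⊤ : Submodule A (M →ₗ[A] N))) {r : N →ₗ[A] M}
    (hr : r ∘ₗ f = LinearMap.id) : Subsingleton M := by
  have h : (⊤ : Submodule A M) ≤ (⊥ : Ideal A).jacobson • ⊤ := by
    intro x _
    have h1 : (⊥ : Ideal A).jacobson • (⊤ : Submodule A (M →ₗ[A] N)) ≤
        ((⊥ : Ideal A).jacobson • (⊤ : Submodule A M)).comap
          (r ∘ₗ LinearMap.applyₗ (R := A) (M₂ := N) x) :=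
      Submodule.smul_le.2 fun c hc φ _ => by
        rw [Submodule.mem_comap, map_smul]
        exact Submodule.smul_mem_smul hc trivial
    have h2 := h1 hf
    simpa [← LinearMap.comp_apply, hr] using h2
  have := Submodule.eq_bot_of_le_smul_of_le_jacobson_bot _ _ Module.Finite.fg_top h le_rfl
  exact (Submodule.subsingleton_iff A).1 (subsingleton_of_bot_eq_top this.symm)

/-- Dimension shifting reduces to a projective module with a minimal resolution of length one; it
splits, contradicting Nakayama. -/
theorem not_hasProjectiveDimensionLT_of_isMinimal [IsLocalRing A] {E : Type u} [AddCommGroup E]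
    [Module A E] {L : ℕ → Type u} [∀ j, AddCommGroup (L j)] [∀ j, Module A (L j)]
    [∀ j, Module.Free A (L j)] [∀ j, Module.Finite A (L j)] {m : ℕ}
    {u : ∀ j, L (j + 1) →ₗ[A] L j} {π : L 0 →ₗ[A] E} (hres : IsResolution m u π)
    (hu : IsMinimal u) (hL : Nontrivial (L m)) :
    ¬ CategoryTheory.HasProjectiveDimensionLT (ModuleCat.of A E) m := by
  induction m generalizing E L with
  | zero =>
    rw [CategoryTheory.hasProjectiveDimensionLT_zero_iff_isZero, ModuleCat.isZero_of_iff_subsingleton]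
    intro h
    exact not_subsingleton (L 0) hres.bijective.injective.subsingleton
  | succ n ih =>
    intro h
    -- Length one is treated apart: projectivity of `E` only makes the syzygy projective, not zero,
    -- so the shift cannot descend to length zero.
    cases n with
    | zero =>
      rw [zero_add, ← CategoryTheory.projective_iff_hasProjectiveDimensionLT_one,
        ← IsProjective.iff_projective] at h
      obtain ⟨s, hs⟩ := Module.projective_lifting_property π LinearMap.id hres.surjective
      let e := LinearEquiv.ofBijective _ hres.ker.bijective
      have hπ : ∀ x, x - s (π x) ∈ LinearMap.ker π := fun x => by
        rw [LinearMap.mem_ker, map_sub, ← LinearMap.comp_apply π s, hs, LinearMap.id_apply,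
          sub_self]
      let r : L 0 →ₗ[A] L 1 := e.symm.toLinearMap ∘ₗ
        (LinearMap.id - s ∘ₗ π).codRestrict (LinearMap.ker π) hπ
      refine not_subsingleton (L 1) (subsingleton_of_leftInverse_of_mem_smul
        (hu.mem_smul_top 0) (r := r) ?_)
      ext x
      refine e.injective ?_
      change e (e.symm _) = e x
      rw [LinearEquiv.apply_symm_apply]
      refine Subtype.ext ?_
      change u 0 x - s (π (u 0 x)) = u 0 x
      rw [(hres.exact_zero _).2 ⟨x, rfl⟩, map_zero, sub_zero]
    | succ n =>
      have hP : CategoryTheory.Projective π.shortComplexKer.X₂ :=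
        (IsProjective.iff_projective (L 0)).1 inferInstance
      exact ih hres.ker (fun j => hu (j + 1)) hL
        (((LinearMap.shortExact_shortComplexKer hres.surjective).hasProjectiveDimensionLT_X₃_iff n
          hP).1 h)

theorem IsResolution.congr {E : Type*} [AddCommGroup E] [Module A E] {E' : Type*}
    [AddCommGroup E'] [Module A E'] {L : ℕ → Type*} [∀ j, AddCommGroup (L j)]
    [∀ j, Module A (L j)] {L' : ℕ → Type*} [∀ j, AddCommGroup (L' j)] [∀ j, Module A (L' j)]
    {m : ℕ} {u : ∀ j, L (j + 1) →ₗ[A] L j} {π : L 0 →ₗ[A] E} (hres : IsResolution m u π)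
    (e : ∀ j, L j ≃ₗ[A] L' j) (f : E ≃ₗ[A] E') :
    IsResolution m (fun j => (e j).toLinearMap ∘ₗ u j ∘ₗ (e (j + 1)).symm.toLinearMap)
      (f.toLinearMap ∘ₗ π ∘ₗ (e 0).symm.toLinearMap) := by
  refine ⟨fun j hj => ?_, fun j x => ?_, fun x => ?_, ?_⟩
  · have := hres.subsingleton j hj
    exact (e j).symm.injective.subsingleton
  · have := hres.exact_succ j ((e (j + 1)).symm x)
    simp only [LinearMap.comp_apply, LinearEquiv.coe_coe, LinearEquiv.map_eq_zero_iff, this,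
      Set.mem_range, LinearEquiv.eq_symm_apply]
    exact (e (j + 2)).symm.surjective.exists (p := fun y => e (j + 1) (u (j + 1) y) = x)
  · have := hres.exact_zero ((e 0).symm x)
    simp only [LinearMap.comp_apply, LinearEquiv.coe_coe, LinearEquiv.map_eq_zero_iff, this,
      Set.mem_range, LinearEquiv.eq_symm_apply]
    exact (e 1).symm.surjective.exists (p := fun y => e 0 (u 0 y) = x)
  · exact f.surjective.comp (hres.surjective.comp (e 0).symm.surjective)

theorem IsMinimal.congr {L : ℕ → Type*} [∀ j, AddCommGroup (L j)] [∀ j, Module A (L j)]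
    {L' : ℕ → Type*} [∀ j, AddCommGroup (L' j)] [∀ j, Module A (L' j)]
    {u : ∀ j, L (j + 1) →ₗ[A] L j} (hu : IsMinimal u) (e : ∀ j, L j ≃ₗ[A] L' j) :
    IsMinimal (fun j => (e j).toLinearMap ∘ₗ u j ∘ₗ (e (j + 1)).symm.toLinearMap) := by
  refine fun j => (Ideal.span_le.2 ?_).trans (hu j)
  rintro _ ⟨x, φ, rfl⟩
  exact Ideal.subset_span ⟨(e (j + 1)).symm x, φ ∘ₗ (e j).toLinearMap, rfl⟩

theorem projDim_eq_of_isMinimal [IsLocalRing A] {E : Type v} [AddCommGroup E] [Module A E]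
    {L : ℕ → Type w} [∀ j, AddCommGroup (L j)] [∀ j, Module A (L j)] [∀ j, Module.Free A (L j)]
    [∀ j, Module.Finite A (L j)] {m : ℕ} {u : ∀ j, L (j + 1) →ₗ[A] L j} {π : L 0 →ₗ[A] E}
    (hres : IsResolution m u π) (hu : IsMinimal u) (hL : Nontrivial (L m)) :
    projDim A E = ((m : ℕ∞) : WithBot ℕ∞) := by
  -- Coordinates move each `L j` into the universe of `A`, and `f` then replaces `E` by a quotient
  -- of the new degree-zero module.
  let e : ∀ j, L j ≃ₗ[A] (Fin (Module.finrank A (L j)) → A) := fun j =>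
    (Module.finBasis A (L j)).equivFun
  have hres₀ := hres.congr e (LinearEquiv.refl A E)
  have hPd : PdLE A E m := ⟨_, _, _, _, _, inferInstance, inferInstance, hres₀⟩
  let f := ((LinearMap.quotKerEquivOfSurjective _ hres₀.surjective).symm : E ≃ₗ[A] _)
  have hnot := not_hasProjectiveDimensionLT_of_isMinimal (hres.congr e f) (hu.congr e)
    (e m).symm.surjective.nontrivial
  have hE : ¬ Subsingleton E := fun h => hnot <| by
    have := CategoryTheory.hasProjectiveDimensionLT_zero_iff_isZero _ |>.2
      (ModuleCat.isZero_of_iff_subsingleton (R := A) |>.2 f.symm.injective.subsingleton)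
    exact CategoryTheory.hasProjectiveDimensionLT_of_ge _ 0 m (Nat.zero_le m)
  rw [projDim, if_neg hE]
  congr 1
  refine le_antisymm (iInf₂_le m hPd) (le_iInf₂ fun n hn => ?_)
  obtain ⟨P, _, _, d, q, _, _, hP⟩ := hn
  by_contra! hlt
  have := hasProjectiveDimensionLT_of_isResolution
    (hP.congr (fun j => LinearEquiv.refl A (P j)) f)
  exact hnot (CategoryTheory.hasProjectiveDimensionLT_of_ge _ (n + 1) m (by exact_mod_cast hlt))

end ProjectiveDimension

/-! ### Radically finitely generated ideals and the grade formula -/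

theorem detIdealOne_fg {A : Type*} [CommRing A] {M N : Type*} [AddCommGroup M] [Module A M]
    [AddCommGroup N] [Module A N] [Module.Free A M] [Module.Finite A M] [Module.Free A N]
    [Module.Finite A N] (f : M →ₗ[A] N) : (detIdealOne f).FG := by
  classical
  rw [detIdealOne_eq_span_toMatrix (Module.Free.chooseBasis A M) (Module.Free.chooseBasis A N)]
  exact Submodule.fg_span (Set.finite_range _)

theorem radGradeGE_iff {A : Type u} [CommRing A] {E : Type v} [AddCommGroup E] [Module A E]
    {L : ℕ → Type w} [∀ j, AddCommGroup (L j)] [∀ j, Module A (L j)] [∀ j, Module.Free A (L j)]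
    [∀ j, Module.Finite A (L j)] {m : ℕ} {u : ∀ j, L (j + 1) →ₗ[A] L j} {π : L 0 →ₗ[A] E}
    (hres : IsResolution m u π) (hL : Nontrivial (L m)) {a : Ideal A}
    (hu : 1 ≤ m → detIdealOne (u (m - 1)) ≤ a) (k : ℕ) :
    RadGradeGE a E k ↔ RadGradeGE a A (m + k) := by
  constructor
  · rintro ⟨b, hb, hba, h⟩
    -- The ideal `b` need not contain `D₁(u_m)`. Adjoining it keeps `b` finitely generated and,
    -- since `D₁(u_m) ≤ a`, does not change the radical.
    obtain ⟨c, hc, hbc, hca, huc⟩ : ∃ c : Ideal A, c.FG ∧ b ≤ c ∧ c ≤ a.radical ∧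
        (1 ≤ m → detIdealOne (u (m - 1)) ≤ c) := by
      have hba' : b ≤ a.radical := hba ▸ Ideal.le_radical
      cases m with
      | zero => exact ⟨b, hb, le_rfl, hba', by simp⟩
      | succ n =>
        exact ⟨b ⊔ detIdealOne (u n), Submodule.FG.sup hb (detIdealOne_fg _), le_sup_left,
          sup_le hba' ((hu (by omega)).trans Ideal.le_radical), fun _ => le_sup_right⟩
    refine ⟨c, hc, le_antisymm (Ideal.radical_le_radical_iff.2 hca)
      (hba ▸ Ideal.radical_mono hbc), ?_⟩
    rw [add_comm]
    exact hres.gradeGE_ring (fun _ => hL) hc huc (h.mono hc hbc)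
  · rintro ⟨b, hb, hba, h⟩
    exact ⟨b, hb, hba, hres.gradeGE (add_comm m k ▸ h)⟩

theorem grade_add_eq {A : Type u} [CommRing A] {E : Type v} [AddCommGroup E] [Module A E]
    {m : ℕ} {a : Ideal A} (ha : IsRadicallyFG a)
    (h : ∀ k, RadGradeGE a E k ↔ RadGradeGE a A (m + k)) :
    grade a E + (m : ℕ∞) = grade a A := by
  -- Adding `m` commutes with a supremum only over a nonempty family; length zero provides a member.
  have h0 : RadGradeGE a E 0 := by
    obtain ⟨b, hb, hba⟩ := ha
    exact ⟨b, hb, hba, gradeGE_zero E⟩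
  have hne : Nonempty {k // RadGradeGE a E k} := ⟨⟨0, h0⟩⟩
  refine le_antisymm ?_ (iSup₂_le fun n hn => ?_)
  · rw [grade, iSup_subtype', ENat.iSup_add]
    refine iSup_le fun k => ?_
    have := le_iSup₂ (f := fun (n : ℕ) (_ : RadGradeGE a A n) => (n : ℕ∞)) _ ((h k.1).1 k.2)
    rw [add_comm]
    exact_mod_cast this
  · rcases le_total n m with hnm | hnm
    · exact le_add_left (by exact_mod_cast hnm)
    · obtain ⟨k, rfl⟩ := Nat.exists_eq_add_of_le hnm
      have := le_iSup₂ (f := fun (n : ℕ) (_ : RadGradeGE a E n) => (n : ℕ∞)) _ ((h k).2 hn)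
      rw [Nat.cast_add, add_comm]
      exact add_le_add_left this _

end ABH

theorem mainTheorem3 {A : Type u} [CommRing A] {E : Type v} [AddCommGroup E] [Module A E]
    {L : ℕ → Type w} [∀ j, AddCommGroup (L j)] [∀ j, Module A (L j)]
    [∀ j, Module.Free A (L j)] [∀ j, Module.Finite A (L j)]
    (m : ℕ) (u : ∀ j, L (j + 1) →ₗ[A] L j) (π : L 0 →ₗ[A] E) (hres : ABH.IsResolution m u π) :
    -- direct part
    (∀ (k : ℕ) (a : Ideal A), a.FG → ABH.GradeGE a A (k + m) → ABH.GradeGE a E k) ∧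
    -- converse part
    (∀ (k : ℕ) (a : Ideal A), a.FG → 1 ≤ m → (∀ j ≤ m, 0 < Module.finrank A (L j)) →
      ABH.detIdealOne (u (m - 1)) ≤ a → ABH.GradeGE a E k → ABH.GradeGE a A (k + m)) ∧
    -- local case, for a minimal resolution of exact length `m`
    (∀ [IsLocalRing A], ABH.IsMinimal u → Nontrivial (L m) →
      ∀ a : Ideal A, ABH.IsRadicallyFG a → (1 ≤ m → ABH.detIdealOne (u (m - 1)) ≤ a) →
        a ≤ IsLocalRing.maximalIdeal A →
        ABH.projDim A E = ((m : ℕ∞) : WithBot ℕ∞) ∧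
        ((ABH.grade a E : ℕ∞) : WithBot ℕ∞) + ABH.projDim A E = ((ABH.grade a A : ℕ∞) : WithBot ℕ∞) ∧
        ∀ k : ℕ, ABH.RadGradeGE a E k ↔ ABH.RadGradeGE a A (m + k)) := by
  refine ⟨fun k a _ h => hres.gradeGE h, fun k a ha _ hrank hu h => ?_,
    fun hmin hL a ha hu _ => ?_⟩
  · exact hres.gradeGE_ring (fun _ => Module.nontrivial_of_finrank_pos (hrank m le_rfl)) ha
      (fun _ => hu) h
  · have hiff := ABH.radGradeGE_iff hres hL hu
    have hpd := ABH.projDim_eq_of_isMinimal hres hmin hL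
    refine ⟨hpd, ?_, hiff⟩
    rw [hpd, ← ABH.grade_add_eq ha hiff, WithBot.coe_add]
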